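/- Let $G=(V,E)$ be a finite simple graph with $n=|V|\ge 2$ vertices that is cobipartite, i.e. whose complement is bipartite. An ordering of $V$ is a bijection $\sigma:V\to\{1,\dots,n\}$. For an ordering $\sigma$, let $\mathrm{LexBFS}^+(G,\sigma)$ be the ordering computed as follows: all vertices start with the empty word as label; at step $i=1,\dots,n$, among the unvisited vertices whose label is lexicographically largest, visit the vertex $v$ that is rightmost in $\sigma$, give it position $i$, and append the letter $n-i$ to the label of each unvisited neighbour of $v$. Let $\mathrm{LexCycle}(G)$ be the maximum length of a cycle of orderings of $V$ under the map $\sigma\mapsto\mathrm{LexBFS}^+(G,\sigma)$. Then $\mathrm{LexCycle}(G)=2$, and the 2-cycle is reached in fewer than $n^2$ sweeps from every starting ordering: for every ordering $\sigma_0$, if $\sigma_{i+1}=\mathrm{LexBFS}^+(G,\sigma_i)$ for all $i\ge 0$, then there is $t<n^2$ such that $\sigma_{t+2}=\sigma_t$ and $\sigma_{t+1}\neq\sigma_t$. -/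

import Mathlib

namespace LexSearch

/-- An ordering of the finite vertex set `V`: a bijection between `V` and the positions
`0, 1, …, n - 1` (position `i` here is position `i + 1` when counting from one). -/
abbrev VertexOrdering (V : Type*) [Fintype V] := V ≃ Fin (Fintype.card V)

/-- The complement of a bipartite graph. -/
def IsCobipartite {V : Type*} (G : SimpleGraph V) : Prop := Gᶜ.IsBipartite

/-- State of the search: the vertices visited so far, in order of their visit, and the current
label of every vertex, a word over the natural numbers. -/
structure State (V : Type*) where
  visited : List V
  label : V → List ℕ

section Search

variable {V : Type*} [Fintype V] [DecidableEq V]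

/-- The vertices that have not been visited (numbered) yet. -/
def State.unvisited (s : State V) : Finset V := Finset.univ.filter (fun v => v ∉ s.visited)

/-- The tied vertices: the unvisited ones with lexicographically largest label. The order on
`List ℕ` is the lexicographic order, in which a proper prefix of a word is smaller than it. -/
def State.tied (s : State V) : Finset V :=
  s.unvisited.filter (fun v => ∀ w ∈ s.unvisited, s.label w ≤ s.label v)

/-- The vertex of a nonempty set `T` that is rightmost in `σ`. -/
def rightmost (σ : VertexOrdering V) (T : Finset V) (hT : T.Nonempty) : V :=
  σ.symm ((T.image σ).max' (hT.image σ))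

/-- The initial state: nothing is visited, all labels are the empty word. -/
def initial (V : Type*) : State V := ⟨[], fun _ => []⟩

/-- The `i`-th step (`i = 1, …, n`) of LexBFS with the `⁺` tie-breaking rule for `σ`: visit the
tied vertex `v` that is rightmost in `σ`, then append the letter `n - i` to the label of each
unvisited neighbour of `v`. -/
def step (G : SimpleGraph V) [DecidableRel G.Adj] (σ : VertexOrdering V) (i : ℕ) (s : State V) :
    State V :=
  if hT : s.tied.Nonempty then
    let v := rightmost σ s.tied hT
    { visited := s.visited ++ [v]
      label := fun w =>
        if w ∉ s.visited ++ [v] ∧ G.Adj v w then s.label w ++ [Fintype.card V - i]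
        else s.label w }
  else s

/-- The state after the first `i` steps. -/
def run (G : SimpleGraph V) [DecidableRel G.Adj] (σ : VertexOrdering V) : ℕ → State V
  | 0 => initial V
  | i + 1 => step G σ (i + 1) (run G σ i)

theorem rightmost_mem (σ : VertexOrdering V) (T : Finset V) (hT : T.Nonempty) :
    rightmost σ T hT ∈ T := by
  obtain ⟨v, hv, h⟩ := Finset.mem_image.1 ((T.image σ).max'_mem (hT.image σ))
  unfold rightmost
  rw [← h, Equiv.symm_apply_apply]
  exact hv

theorem State.tied_nonempty (s : State V) (h : s.unvisited.Nonempty) : s.tied.Nonempty := by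
  obtain ⟨v, hv, hmax⟩ := Finset.exists_max_image s.unvisited s.label h
  exact ⟨v, Finset.mem_filter.2 ⟨hv, hmax⟩⟩

theorem run_visited (G : SimpleGraph V) [DecidableRel G.Adj] (σ : VertexOrdering V) (i : ℕ)
    (hi : i ≤ Fintype.card V) :
    (run G σ i).visited.Nodup ∧ (run G σ i).visited.length = i := by
  induction i with
  | zero => simp [run, initial]
  | succ i ih =>
    obtain ⟨h1, h2⟩ := ih (by omega)
    have hne : (run G σ i).unvisited.Nonempty := by
      by_contra hcon
      rw [Finset.not_nonempty_iff_eq_empty] at hcon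
      have hall : ∀ v : V, v ∈ (run G σ i).visited := by
        intro v
        by_contra hv
        have hmem : v ∈ (run G σ i).unvisited := Finset.mem_filter.2 ⟨Finset.mem_univ v, hv⟩
        simp [hcon] at hmem
      have hu : (run G σ i).visited.toFinset = Finset.univ := by
        ext v
        simp [hall v]
      have hc := List.toFinset_card_of_nodup h1
      rw [hu, Finset.card_univ] at hc
      omega
    have hT := State.tied_nonempty _ hne
    have hv : rightmost σ _ hT ∉ (run G σ i).visited :=
      (Finset.mem_filter.1 (Finset.mem_filter.1 (rightmost_mem σ _ hT)).1).2
    have hs : (run G σ (i + 1)).visited = (run G σ i).visited ++ [rightmost σ _ hT] := by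
      simp only [run, step, dif_pos hT]
    rw [hs]
    refine ⟨?_, by simp [h2]⟩
    rw [List.nodup_append]
    refine ⟨h1, List.nodup_singleton _, ?_⟩
    intro a ha b hb hab
    rw [List.mem_singleton] at hb
    exact hv (hb ▸ hab ▸ ha)

theorem mem_run_visited (G : SimpleGraph V) [DecidableRel G.Adj] (σ : VertexOrdering V) (v : V) :
    v ∈ (run G σ (Fintype.card V)).visited := by
  obtain ⟨h1, h2⟩ := run_visited G σ (Fintype.card V) le_rfl
  have hu : (run G σ (Fintype.card V)).visited.toFinset = Finset.univ := by
    apply Finset.eq_univ_of_card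
    rw [List.toFinset_card_of_nodup h1, h2]
  rw [← List.mem_toFinset, hu]
  exact Finset.mem_univ v

/-- The ordering `LexBFS⁺(G, σ)`: the vertices in the order in which the `n` steps visit them. -/
def lexBFSPlus (G : SimpleGraph V) [DecidableRel G.Adj] (σ : VertexOrdering V) : VertexOrdering V :=
  ((finCongr (run_visited G σ (Fintype.card V) le_rfl).2.symm).trans
    ((run_visited G σ (Fintype.card V) le_rfl).1.getEquivOfForallMemList _
      (mem_run_visited G σ))).symm

/-- `LexCycle(G)`: the maximum length of a cycle of `σ ↦ LexBFS⁺(G, σ)`. The length of the cycle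
through `σ` is the minimal period of `σ` under iteration (which is `0`, hence irrelevant to the
maximum, if `σ` does not lie on a cycle). -/
noncomputable def lexCycle (G : SimpleGraph V) [DecidableRel G.Adj] : ℕ :=
  Finset.univ.sup (fun σ : VertexOrdering V => Function.minimalPeriod (lexBFSPlus G) σ)

end Search

end LexSearch

/-! Let `A` and `Aᶜ` be cliques. If `S ⊆ A` ends an ordering, the next sweep opens with `S` reversed
and ends with the vertices that have a non-neighbour in `S` (`Sweep.reverse`, `Sweep.upper_coNbr`).
Two sweeps therefore sort `Aᶜ` by adjacency to `S`, up to ties (`Sweep.lt_of_first_diff`). If the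
vertex just before `S`, watched every second sweep, stays in `A`, it can only climb in a strict
order `Prec` fixed by the order of `S`, and once it repeats it never moves again
(`Sweep.prec_of_lt`, `Sweep.not_prec`). So the frozen suffix grows vertex by vertex until it is `A`,
within about `|A|(|A| + 1)` sweeps (`exists_stableFrom`).

The argument runs twice. A sweep restricts to a sweep on each component of `Gᶜ` (`Sweep.induce`);
there connectedness keeps the next vertex in `A`, and a side of the component becomes a suffix of
it. Then no vertex lies between two of its non-neighbours (`not_between`), which makes a clique with
clique complement a suffix of the whole ordering (`exists_upper_clique`). The second run, on the
whole graph, freezes that side and forces period two (`exists_periodic_of_upper`). Using the smaller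
side, of at most `n / 2` vertices, keeps the total below `n²`. No ordering is fixed, since a sweep
begins with the last vertex of its input. -/

namespace LexSearch

/-! ### Clique suffixes under one and two sweeps -/

section Sweeps

variable {V : Type*} {G : SimpleGraph V}

/-- The ordering `τ` (given by positions) is the LexBFS ordering of `G` with ties broken in favour
of the rightmost vertex of `σ`: if `u` precedes `v` in `τ`, then either the first vertex that tells
them apart is a neighbour of `u`, or no earlier vertex does and `u` is to the right of `v`. -/
def Sweep (G : SimpleGraph V) (σ τ : V → ℕ) : Prop :=
  ∀ u v, τ u < τ v →
    (∃ w, τ w < τ u ∧ G.Adj w u ∧ ¬ G.Adj w v ∧ ∀ x, τ x < τ w → (G.Adj x u ↔ G.Adj x v)) ∨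
    ((∀ x, τ x < τ u → (G.Adj x u ↔ G.Adj x v)) ∧ σ v < σ u)

/-- `S` is a set of last vertices of the ordering `σ`. -/
def Upper (σ : V → ℕ) (S : Set V) : Prop := ∀ u ∈ S, ∀ v ∉ S, σ v < σ u

/-- The set of vertices with a non-neighbour in `S`. -/
def coNbr (G : SimpleGraph V) (S : Set V) : Set V := {v | ∃ s ∈ S, Gᶜ.Adj s v}

theorem coNbr_subset_compl {S A : Set V} (hA : G.IsClique A) (hS : S ⊆ A) : coNbr G S ⊆ Aᶜ := by
  rintro v ⟨s, hs, hv⟩ hvA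
  rw [SimpleGraph.compl_adj] at hv
  exact hv.2 (hA (hS hs) hvA hv.1)

/-- Consider the earliest violating `v` in `τ`. Everything before it lies in the clique `S`, so
nothing there misses `u`, and the tie rule favours `u`. -/
theorem Sweep.reverse {σ τ : V → ℕ} (h : Sweep G σ τ) (hτ : τ.Injective) {S : Set V}
    (hS : Upper σ S) (hc : G.IsClique S) {u v : V} (hu : u ∈ S) (huv : σ v < σ u) :
    τ u < τ v := by
  by_contra hcon
  have hne : v ≠ u := by rintro rfl; omega
  have hlt : τ v < τ u := lt_of_le_of_ne (not_lt.1 hcon) (fun e => hne (hτ e))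
  induction hk : τ v using Nat.strong_induction_on generalizing v with
  | _ k ih =>
    subst hk
    have hmem : ∀ x, τ x < τ v → x ∈ S := by
      intro x hx
      by_contra hxS
      have hxu := hS u hu x hxS
      refine ih (τ x) hx hxu (by omega) ?_ (by omega) rfl
      rintro rfl; omega
    rcases h v u hlt with ⟨w, hw, -, hwu, -⟩ | ⟨-, h2⟩
    · refine hwu (hc (hmem w hw) hu ?_)
      rintro rfl; omega
    · omega

theorem Sweep.upper_compl {σ τ : V → ℕ} (h : Sweep G σ τ) (hτ : τ.Injective) {S : Set V}
    (hS : Upper σ S) (hc : G.IsClique S) : Upper τ Sᶜ := by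
  intro u hu v hv
  rw [Set.notMem_compl_iff] at hv
  exact h.reverse hτ hS hc hv (hS v hv u hu)

/-- Since `S` is read first, a vertex that sees all of `S` beats one that misses part of it. -/
theorem Sweep.upper_coNbr {σ τ : V → ℕ} (h : Sweep G σ τ) (hτ : τ.Injective) {S : Set V}
    (hS : Upper τ Sᶜ) (hc : G.IsClique S) : Upper τ (coNbr G S) := by
  rintro v ⟨s, hs, hsv⟩ u hu
  rw [SimpleGraph.compl_adj] at hsv
  have hvS : v ∉ S := fun hvS => hsv.2 (hc hs hvS hsv.1)
  have hsv' : τ s < τ v := hS v hvS s (by simpa using hs)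
  by_contra hcon
  have hne : v ≠ u := by rintro rfl; exact hu ⟨s, hs, by simpa using hsv⟩
  have hlt : τ v < τ u := lt_of_le_of_ne (not_lt.1 hcon) (fun e => hne (hτ e))
  have hadj : ∀ x ∈ S, G.Adj x u := by
    intro x hx
    by_contra hxu
    have hxne : x ≠ u := by
      rintro rfl
      have := hS v hvS x (by simpa using hx)
      omega
    exact hu ⟨x, hx, by simp [hxu, hxne]⟩
  rcases h v u hlt with ⟨w, hw, hwv, hwu, hag⟩ | ⟨hag, -⟩
  · have hwS : w ∉ S := fun hwS => hwu (hadj w hwS)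
    exact hsv.2 ((hag s (hS w hwS s (by simpa using hs))).2 (hadj s hs))
  · exact hsv.2 ((hag s hsv').2 (hadj s hs))

/-- The first sweep reads `S` from right to left and so puts `b'` before `b`. As `b` then lies in
the clique suffix `coNbr G S`, the second sweep reverses the two. -/
theorem Sweep.lt_of_first_diff {f₀ f₁ f₂ : V → ℕ} (h₁ : Sweep G f₀ f₁) (h₂ : Sweep G f₁ f₂)
    (i₀ : f₀.Injective) (i₁ : f₁.Injective) (i₂ : f₂.Injective) {A S : Set V} (hA : G.IsClique A)
    (hB : G.IsClique Aᶜ) (hSA : S ⊆ A) (hS : Upper f₀ S) {b b' s : V} (hb : b ∉ A) (hs : s ∈ S)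
    (hsb : ¬ G.Adj s b) (hsb' : G.Adj s b')
    (hag : ∀ x ∈ S, f₀ s < f₀ x → (G.Adj x b ↔ G.Adj x b')) : f₂ b < f₂ b' := by
  have hlow := h₁.upper_compl i₁ hS (hA.subset hSA)
  have hbS : b ∉ S := fun h => hb (hSA h)
  have hbT : b ∈ coNbr G S := by
    refine ⟨s, hs, ?_⟩
    rw [SimpleGraph.compl_adj]
    exact ⟨fun e => hbS (e ▸ hs), hsb⟩
  have hT := h₁.upper_coNbr i₁ hlow (hA.subset hSA)
  refine h₂.reverse i₂ hT (hB.subset (coNbr_subset_compl hA hSA)) hbT ?_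
  by_contra hcon
  have hne : b ≠ b' := by rintro rfl; exact hsb hsb'
  have hlt : f₁ b < f₁ b' := lt_of_le_of_ne (not_lt.1 hcon) (fun e => hne (i₁ e))
  have hs1 : f₁ s < f₁ b := hlow b hbS s (by simpa using hs)
  rcases h₁ b b' hlt with ⟨w, hw, hwb, hwb', hag'⟩ | ⟨hag', -⟩
  · have hws : w ≠ s := by rintro rfl; exact hsb hwb
    rcases lt_or_gt_of_ne (fun e => hws (i₁ e)) with hlt' | hlt'
    · have hwS : w ∈ S := by
        by_contra hwS
        have := hlow w hwS s (by simpa using hs)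
        omega
      have h0 : f₀ s < f₀ w := by
        by_contra hc0
        have h0' : f₀ w < f₀ s := lt_of_le_of_ne (not_lt.1 hc0) (fun e => hws (i₀ e))
        have := h₁.reverse i₁ hS (hA.subset hSA) hs h0'
        omega
      exact hwb' ((hag w hwS h0).1 hwb)
    · exact hsb ((hag' s hlt').2 hsb')
  · exact hsb ((hag' s hs1).2 hsb')

/-! ### The strict order on candidates for the next vertex of a suffix -/

/-- `key` sorts the vertices by their adjacencies to `S`, read from right to left in `p`. -/
def IsKey (G : SimpleGraph V) (S : Set V) (p : V → ℕ) {K : Type*} [LinearOrder K] (key : V → K) :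
    Prop :=
  (∀ b b', key b < key b' → ∃ s ∈ S, ¬ G.Adj s b ∧ G.Adj s b' ∧
    ∀ x ∈ S, p s < p x → (G.Adj x b ↔ G.Adj x b')) ∧
  ∀ b b', key b = key b' → ∀ s ∈ S, (G.Adj s b ↔ G.Adj s b')

/-- Code `b` by the positions of its neighbours in `S`: colex compares two such sets at the largest
position where they differ. -/
theorem exists_isKey [Finite V] (G : SimpleGraph V) (S : Set V) {p : V → ℕ} (hp : p.Injective) :
    ∃ key : V → Colex (Finset ℕ), IsKey G S p key := by
  classical
  have := Fintype.ofFinite V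
  let c : V → Finset ℕ := fun b => (Finset.univ.filter (fun s => s ∈ S ∧ G.Adj s b)).image p
  have hc : ∀ b s, p s ∈ c b ↔ s ∈ S ∧ G.Adj s b := by
    intro b s
    simp only [c, Finset.mem_image, Finset.mem_filter, Finset.mem_univ, true_and]
    constructor
    · rintro ⟨x, hx, e⟩
      rwa [← hp e]
    · exact fun h => ⟨s, h, rfl⟩
  have hc' : ∀ b n, n ∈ c b → ∃ s, p s = n := by
    intro b n hn
    obtain ⟨x, -, e⟩ := Finset.mem_image.1 hn
    exact ⟨x, e⟩
  refine ⟨fun b => toColex (c b), ?_, ?_⟩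
  · intro b b' hlt
    change toColex (c b) < toColex (c b') at hlt
    rw [Finset.Colex.toColex_lt_toColex_iff_max'_mem] at hlt
    obtain ⟨hne', hm⟩ := hlt
    have hmax := Finset.max'_mem (symmDiff (c b) (c b')) (Finset.symmDiff_nonempty.2 hne')
    have hle : ∀ y ∈ symmDiff (c b) (c b'),
        y ≤ (symmDiff (c b) (c b')).max' (Finset.symmDiff_nonempty.2 hne') :=
      fun y hy => Finset.le_max' _ y hy
    generalize (symmDiff (c b) (c b')).max' (Finset.symmDiff_nonempty.2 hne') = m at hm hmax hle
    obtain ⟨s, rfl⟩ := hc' _ _ hm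
    have hs := (hc b' s).1 hm
    refine ⟨s, hs.1, ?_, hs.2, ?_⟩
    · intro hsb
      rw [Finset.mem_symmDiff, hc, hc] at hmax
      tauto
    · intro x hx hlt
      have hx' : p x ∉ symmDiff (c b) (c b') := fun hx' => by
        have := hle _ hx'
        omega
      rw [Finset.mem_symmDiff, hc, hc] at hx'
      tauto
  · intro b b' e s hs
    have e' : c b = c b' := toColex_inj.1 e
    have h1 := hc b s
    rw [e', hc] at h1
    tauto

/-- The vertex `u'` beats `u` as the next vertex below the suffix of `A` that is coded by `key`. -/
def Prec (G : SimpleGraph V) (A : Set V) {K : Type*} [LinearOrder K] (key : V → K) (u u' : V) :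
    Prop :=
  ∃ w ∉ A, G.Adj w u ∧ ¬ G.Adj w u' ∧ ∀ b ∉ A, (key b < key w → (G.Adj b u ↔ G.Adj b u')) ∧
    (key b = key w → ¬ G.Adj b u → ¬ G.Adj b u')

theorem Prec.irrefl {A : Set V} {K : Type*} [LinearOrder K] {key : V → K} {u : V} :
    ¬ Prec G A key u u := fun ⟨_, _, h1, h2, _⟩ => h2 h1

/-- `Prec` is lexicographic over the key classes outside `A`: in the first class where the two
neighbourhoods differ, the winner's is a proper subset of the loser's. The witness of smaller key
serves for the composite. -/
theorem Prec.trans {A : Set V} {K : Type*} [LinearOrder K] {key : V → K} {u v x : V}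
    (h1 : Prec G A key u v) (h2 : Prec G A key v x) : Prec G A key u x := by
  obtain ⟨w, hw, a1, a2, a3⟩ := h1
  obtain ⟨w', hw', b1, b2, b3⟩ := h2
  rcases lt_trichotomy (key w) (key w') with h | h | h
  · refine ⟨w, hw, a1, fun hh => a2 (((b3 w hw).1 h).2 hh), fun b hb => ⟨fun hk => ?_, fun hk => ?_⟩⟩
    · exact ((a3 b hb).1 hk).trans ((b3 b hb).1 (hk.trans h))
    · intro hu hx
      exact (a3 b hb).2 hk hu (((b3 b hb).1 (hk ▸ h)).2 hx)
  · refine ⟨w, hw, a1, (b3 w hw).2 h a2, fun b hb => ⟨fun hk => ?_, fun hk => ?_⟩⟩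
    · exact ((a3 b hb).1 hk).trans ((b3 b hb).1 (h ▸ hk))
    · intro hu
      exact (b3 b hb).2 (hk.trans h) ((a3 b hb).2 hk hu)
  · refine ⟨w', hw', ((a3 w' hw').1 h).2 b1, b2, fun b hb => ⟨fun hk => ?_, fun hk => ?_⟩⟩
    · exact ((a3 b hb).1 (hk.trans h)).trans ((b3 b hb).1 hk)
    · intro hu
      exact (b3 b hb).2 hk (fun hv => hu (((a3 b hb).1 (hk ▸ h)).2 hv))

theorem mem_of_adj_of_clique_compl {A : Set V} (hB : G.IsClique Aᶜ) {x y : V} (hy : y ∉ A)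
    (hne : x ≠ y) (h : ¬ G.Adj x y) : x ∈ A := by
  by_contra hx
  exact h (hB hx hy hne)

theorem notMem_of_not_adj {A : Set V} (hA : G.IsClique A) {x y : V} (hy : y ∈ A)
    (hne : x ≠ y) (h : ¬ G.Adj x y) : x ∉ A := fun hx => h (hA hx hy hne)

/-- The first sweep puts `u` before `u'`, so in the second the tie rule cannot favour `u`, and some
`w` outside `A` tells them apart. Vertices with a smaller key than `w`, or with the same key and not
adjacent to `u`, precede `w` and hence do not distinguish `u` from `u'`. -/
theorem Sweep.prec_of_lt {f₀ f₁ f₂ : V → ℕ} (h₁ : Sweep G f₀ f₁) (h₂ : Sweep G f₁ f₂)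
    (i₀ : f₀.Injective) (i₁ : f₁.Injective) (i₂ : f₂.Injective) {A S : Set V} (hA : G.IsClique A)
    (hB : G.IsClique Aᶜ) {K : Type*} [LinearOrder K] {key : V → K} (hkey : IsKey G S f₀ key)
    (hSA : S ⊆ A) (hS : Upper f₀ S) {u u' : V} (hu : u ∈ A) (hSu : Upper f₀ (insert u S))
    (hu' : u' ∈ A) (hu'S : u' ∉ S) (hlt : f₂ u < f₂ u') : Prec G A key u u' := by
  have hne : u' ≠ u := by rintro rfl; omega
  have hSuA : insert u S ⊆ A := Set.insert_subset hu hSA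
  have h1 : f₁ u < f₁ u' := h₁.reverse i₁ hSu (hA.subset hSuA) (Set.mem_insert _ _)
    (hSu u (Set.mem_insert _ _) u' (by simp [hne, hu'S]))
  rcases h₂ u u' hlt with ⟨w, hw, hwu, hwu', hag⟩ | ⟨-, h2⟩
  · have hwA : w ∉ A := notMem_of_not_adj hA hu' (by rintro rfl; omega) hwu'
    refine ⟨w, hwA, hwu, hwu', fun b hb => ⟨fun hk => ?_, fun hk hbu => ?_⟩⟩
    · obtain ⟨s, hs, hsb, hsw, hag'⟩ := hkey.1 b w hk
      exact hag b (h₁.lt_of_first_diff h₂ i₀ i₁ i₂ hA hB hSA hS hb hs hsb hsw hag')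
    · have : f₂ b < f₂ w := by
        refine h₁.lt_of_first_diff h₂ i₀ i₁ i₂ hA hB hSuA hSu hb (Set.mem_insert _ _)
          (fun e => hbu e.symm) hwu.symm ?_
        rintro x (rfl | hx) hlt'
        · omega
        · exact hkey.2 b w hk x hx
      rwa [← hag b this]
  · omega

/-- If the witness `w` precedes `u'`, then no vertex favouring `u'` over `u` is read before `w`,
which favours `u`. The role of `hgood` is to make `w` precede `u'`. -/
theorem Sweep.not_prec {f₀ f₁ f₂ : V → ℕ} (h₁ : Sweep G f₀ f₁) (h₂ : Sweep G f₁ f₂)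
    (i₀ : f₀.Injective) (i₁ : f₁.Injective) (i₂ : f₂.Injective) {A S : Set V} (hA : G.IsClique A)
    (hB : G.IsClique Aᶜ) {K : Type*} [LinearOrder K] {key : V → K} (hkey : IsKey G S f₀ key)
    (hSA : S ⊆ A) (hS : Upper f₀ S) {u u' : V} (hu : u ∈ A) (hSu : Upper f₀ (insert u S))
    (hu' : u' ∈ A) (hlt : f₂ u' < f₂ u)
    (hgood : Upper f₂ A ∨ ∀ v, ∃ x, Gᶜ.Adj v x) : ¬ Prec G A key u u' := by
  rintro ⟨w, hwA, hwu, hwu', hw⟩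
  have hSuA : insert u S ⊆ A := Set.insert_subset hu hSA
  have hwlt : f₂ w < f₂ u' := by
    rcases hgood with hup | hiso
    · exact hup u' hu' w hwA
    by_contra hcon
    have hwne : w ≠ u' := by rintro rfl; exact hwA hu'
    have hlt' : f₂ u' < f₂ w := lt_of_le_of_ne (not_lt.1 hcon) (fun e => hwne (i₂ e).symm)
    set T := coNbr G (insert u S) with hTdef
    have hTA : T ⊆ Aᶜ := coNbr_subset_compl hA hSuA
    have hT : Upper f₁ T := h₁.upper_coNbr i₁ (h₁.upper_compl i₁ hSu (hA.subset hSuA))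
      (hA.subset hSuA)
    have hT2 : Upper f₂ Tᶜ := h₂.upper_compl i₂ hT (hB.subset hTA)
    have hu'T : u' ∈ Tᶜ := fun h => hTA h hu'
    have hwT : w ∉ T := fun h => hcon (hT2 u' hu'T w (by simpa using h))
    -- `T` opens `f₂`, so some `c ∈ T` missing `u'` but seeing `w` would put `w` before `u'`.
    have hfull : ∀ c ∈ T, G.Adj c u' := by
      intro c hc
      by_contra hcu
      have hcw : G.Adj c w := hB (hTA hc) hwA (fun e => hwT (e ▸ hc))
      have hclt : f₂ c < f₂ u' := hT2 u' hu'T c (by simpa using hc)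
      rcases h₂ u' w hlt' with ⟨y, hy, hyu, hyw, hag⟩ | ⟨hag, -⟩
      · have hyA : y ∈ A := mem_of_adj_of_clique_compl hB hwA (by rintro rfl; omega) hyw
        have := hT2 y (fun h => hTA h hyA) c (by simpa using hc)
        exact hcu ((hag c this).2 hcw)
      · exact hcu ((hag c hclt).2 hcw)
    -- A non-neighbour of `u` is in `T`, so it sees `u'` but not `u`. `Prec` forbids this up to the
    -- key of `w`, and a larger key would put `w` into `T`.
    obtain ⟨x, hux⟩ := hiso u
    have hxT : x ∈ T := ⟨u, Set.mem_insert _ _, hux⟩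
    rw [SimpleGraph.compl_adj] at hux
    have hxu : ¬ G.Adj x u := fun h => hux.2 h.symm
    rcases lt_trichotomy (key x) (key w) with hk | hk | hk
    · exact hxu (((hw x (hTA hxT)).1 hk).2 (hfull x hxT))
    · exact (hw x (hTA hxT)).2 hk hxu (hfull x hxT)
    · obtain ⟨s, hs, hsw, -⟩ := hkey.1 w x hk
      refine hwT ⟨s, Set.mem_insert_of_mem _ hs, ?_⟩
      rw [SimpleGraph.compl_adj]
      exact ⟨fun e => hwA (e ▸ hSA hs), hsw⟩
  rcases h₂ u' u hlt with ⟨x, hx, hxu', hxu, hag⟩ | ⟨hag, -⟩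
  · have hxA : x ∉ A := notMem_of_not_adj hA hu (by rintro rfl; omega) hxu
    rcases lt_trichotomy (key x) (key w) with hk | hk | hk
    · exact hxu (((hw x hxA).1 hk).2 hxu')
    · exact (hw x hxA).2 hk hxu hxu'
    · obtain ⟨s, hs, hsw, hsx, hag'⟩ := hkey.1 w x hk
      have := h₁.lt_of_first_diff h₂ i₀ i₁ i₂ hA hB hSA hS hwA hs hsw hsx hag'
      exact hwu' ((hag w this).2 hwu)
  · exact hwu' ((hag w hwlt).2 hwu)

end Sweeps

/-! ### Freezing one side, and period two -/

section Stabilisation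

variable {V : Type*} {G : SimpleGraph V}

/-- `u` is the rightmost vertex of `σ` outside `S`. -/
def IsNext (σ : V → ℕ) (S : Set V) (u : V) : Prop := u ∉ S ∧ ∀ v ∉ S, v ≠ u → σ v < σ u

theorem exists_isNext [Finite V] {σ : V → ℕ} (hσ : σ.Injective) {S : Set V} (hS : Sᶜ.Nonempty) :
    ∃ u, IsNext σ S u := by
  obtain ⟨u, hu, hmax⟩ := Set.exists_max_image Sᶜ σ (Set.toFinite _) hS
  exact ⟨u, hu, fun v hv hne => lt_of_le_of_ne (hmax v hv) (fun e => hne (hσ e))⟩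

theorem IsNext.upper {σ : V → ℕ} {S : Set V} {u : V} (h : IsNext σ S u) (hS : Upper σ S) :
    Upper σ (insert u S) := by
  rintro x hx v hv
  rw [Set.mem_insert_iff, not_or] at hv
  rcases hx with rfl | hx
  · exact h.2 v hv.2 hv.1
  · exact hS x hx v hv.2

theorem upper_empty (σ : V → ℕ) : Upper σ ∅ := fun _ hu => hu.elim

/-- From index `k₀` on, all orderings `f k` end with the vertices of `S` in the same order. -/
def StableFrom (f : ℕ → V → ℕ) (S : Set V) (k₀ : ℕ) : Prop :=
  ∀ k, k₀ ≤ k → Upper (f k) S ∧ ∀ x ∈ S, ∀ y ∈ S, f k₀ x < f k₀ y → f k x < f k y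

theorem IsKey.congr {S : Set V} {p q : V → ℕ} {K : Type*} [LinearOrder K] {key : V → K}
    (h : IsKey G S p key) (hpq : ∀ x ∈ S, ∀ y ∈ S, q x < q y → p x < p y) : IsKey G S q key := by
  refine ⟨fun b b' hlt => ?_, h.2⟩
  obtain ⟨s, hs, h1, h2, h3⟩ := h.1 b b' hlt
  exact ⟨s, hs, h1, h2, fun x hx hlt' => h3 x hx (hpq s hs x hx hlt')⟩

theorem not_chain [Finite V] {R : V → V → Prop} (hirr : ∀ u, ¬ R u u)
    (htr : ∀ u v w, R u v → R v w → R u w) (D : Set V) (u : ℕ → V)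
    (hD : ∀ k ≤ D.ncard, u k ∈ D) : ¬ ∀ k < D.ncard, R (u k) (u (k + 1)) := by
  intro hR
  have hlt : ∀ i j, i < j → j ≤ D.ncard → R (u i) (u j) := by
    intro i j hij
    induction j, hij using Nat.le_induction with
    | base => exact fun hj => hR i hj
    | succ j _ ih => exact fun hj => htr _ _ _ (ih (by omega)) (hR j hj)
  have hinj : Set.InjOn u (Set.Iic D.ncard) := by
    intro i hi j hj e
    rcases lt_trichotomy i j with h | h | h
    · exact absurd (e ▸ hlt i j h hj) (hirr _)
    · exact h
    · exact absurd (e ▸ hlt j i h hi) (hirr _)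
  have hcard := Set.ncard_le_ncard (s := u '' Set.Iic D.ncard) (t := D)
    (by rintro _ ⟨k, hk, rfl⟩; exact hD k hk)
  rw [hinj.ncard_image, ← Finset.coe_Iic, Set.ncard_coe_finset, Nat.card_Iic] at hcard
  omega

/-- While `S` is frozen so is its key, and every change of the next vertex climbs in `Prec` on `A \
S`, which bounds the number of changes before the first repeat. -/
theorem StableFrom.extend [Finite V] {f g : ℕ → V → ℕ} (hf : ∀ k, Sweep G (f k) (g k))
    (hg : ∀ k, Sweep G (g k) (f (k + 1))) (fi : ∀ k, (f k).Injective) (gi : ∀ k, (g k).Injective)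
    {A S : Set V} (hA : G.IsClique A) (hB : G.IsClique Aᶜ) (hSA : S ⊆ A) (hne : S ≠ A)
    {k₀ k₁ : ℕ} (h : StableFrom f S k₀) (h01 : k₀ ≤ k₁)
    (hnext : ∀ k, k₁ ≤ k → ∀ u, IsNext (f k) S u → u ∈ A)
    (hgood : ∀ k, Upper (f (k + 1)) A ∨ ∀ v, ∃ x, Gᶜ.Adj v x) :
    ∃ u ∈ A, u ∉ S ∧ ∃ k₂, k₂ + 1 ≤ k₁ + (A \ S).ncard ∧ StableFrom f (insert u S) k₂ := by
  have hSc : Sᶜ.Nonempty := by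
    obtain ⟨x, -, hx⟩ := Set.exists_of_ssubset (hSA.ssubset_of_ne hne)
    exact ⟨x, hx⟩
  choose u hu using fun k => exists_isNext (fi k) hSc
  have huA : ∀ k, k₁ ≤ k → u k ∈ A := fun k hk => hnext k hk _ (hu k)
  have hS : ∀ k, k₁ ≤ k → Upper (f k) S := fun k hk => (h k (h01.trans hk)).1
  have hSu : ∀ k, k₁ ≤ k → Upper (f k) (insert (u k) S) := fun k hk => (hu k).upper (hS k hk)
  have hmono : ∀ k, k₁ ≤ k → ∀ x ∈ S, ∀ y ∈ S, f k x < f k y → f k₀ x < f k₀ y := by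
    intro k hk x hx y hy hlt
    by_contra hcon
    have hxy : y ≠ x := by rintro rfl; omega
    have := (h k (h01.trans hk)).2 y hy x hx
      (lt_of_le_of_ne (not_lt.1 hcon) (fun e => hxy (fi _ e)))
    omega
  obtain ⟨key, hkey₀⟩ := exists_isKey G S (fi k₀)
  have hkey : ∀ k, k₁ ≤ k → IsKey G S (f k) key := fun k hk => hkey₀.congr (hmono k hk)
  have hprec : ∀ k, k₁ ≤ k → u (k + 1) ≠ u k → Prec G A key (u k) (u (k + 1)) := by
    intro k hk hne'
    exact (hf k).prec_of_lt (hg k) (fi k) (gi k) (fi _) hA hB (hkey k hk) hSA (hS k hk) (huA k hk)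
      (hSu k hk) (huA _ (by omega)) (hu _).1 ((hu _).2 _ (hu k).1 hne'.symm)
  -- After a repeat, `u (k + 2)` is left of `u k` in `f (k + 1)`, so `not_prec` forbids the climb
  -- that a change would require.
  have hpersist : ∀ k, k₁ ≤ k → u (k + 1) = u k → u (k + 2) = u (k + 1) := by
    intro k hk e
    by_contra hne'
    have hp := hprec (k + 1) (by omega) hne'
    rw [e] at hp
    refine (hf k).not_prec (hg k) (fi k) (gi k) (fi _) hA hB (hkey k hk) hSA (hS k hk) (huA k hk)
      (hSu k hk) (huA _ (by omega)) ?_ (hgood k) hp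
    rw [← e]
    exact (hu (k + 1)).2 _ (hu _).1 hne'
  obtain ⟨i, hi, e⟩ : ∃ i < (A \ S).ncard, u (k₁ + i + 1) = u (k₁ + i) := by
    by_contra! hcon
    refine not_chain (R := Prec G A key) (fun _ => Prec.irrefl) (fun _ _ _ => Prec.trans) (A \ S)
      (fun i => u (k₁ + i)) (fun i _ => ⟨huA _ (by omega), (hu _).1⟩) (fun i hi => ?_)
    exact hprec _ (by omega) (hcon i hi)
  have hconst : ∀ k, k₁ + i ≤ k → u (k + 1) = u k ∧ u k = u (k₁ + i) := by
    intro k hk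
    induction k, hk using Nat.le_induction with
    | base => exact ⟨e, rfl⟩
    | succ k hk ih => exact ⟨hpersist k (by omega) ih.1, ih.1.trans ih.2⟩
  refine ⟨u (k₁ + i), huA _ (by omega), (hu _).1, k₁ + i, by omega, fun k hk => ?_⟩
  have hup := hSu k (by omega)
  rw [(hconst k hk).2] at hup
  refine ⟨hup, ?_⟩
  have hSk := hS k (by omega)
  have hS0 := hS (k₁ + i) (by omega)
  rintro x (rfl | hx) y (rfl | hy) hlt
  · omega
  · exact hSk y hy _ (hu _).1
  · have := hS0 x hx _ (hu (k₁ + i)).1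
    omega
  · exact (h k (by omega)).2 x hx y hy (hmono _ (by omega) x hx y hy hlt)

theorem exists_stableFrom [Finite V] {f g : ℕ → V → ℕ} (hf : ∀ k, Sweep G (f k) (g k))
    (hg : ∀ k, Sweep G (g k) (f (k + 1))) (fi : ∀ k, (f k).Injective) (gi : ∀ k, (g k).Injective)
    {A : Set V} (hA : G.IsClique A) (hB : G.IsClique Aᶜ) (hne : A.Nonempty)
    (hlast : ∀ k u, IsNext (f k) ∅ u → u ∈ A)
    (hnext : ∀ k S, S.Nonempty → S ⊆ A → S ≠ A → Upper (f k) S →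
      ∀ u, IsNext (f (k + 1)) S u → u ∈ A)
    (hgood : ∀ k, Upper (f (k + 1)) A ∨ ∀ v, ∃ x, Gᶜ.Adj v x) :
    ∃ k, 2 * k + 2 ≤ A.ncard * (A.ncard + 1) ∧ StableFrom f A k := by
  have hpos : 1 ≤ A.ncard := (Set.ncard_pos).2 hne
  -- With `a = A.ncard`, successive vertices take at most `a, a - 1, …` double sweeps; this is `2 *
  -- k + 2 ≤ 2 * (a + (a - 1) + ⋯ + (a - j + 1))` without subtraction.
  have key : ∀ j, 1 ≤ j → j ≤ A.ncard → ∃ S ⊆ A, S.ncard = j ∧ ∃ k,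
      2 * k + 2 + j * j ≤ j * (2 * A.ncard + 1) ∧ StableFrom f S k := by
    intro j hj
    induction j, hj using Nat.le_induction with
    | base =>
      intro _
      have h0 : StableFrom f (∅ : Set V) 0 := fun k _ => ⟨upper_empty _, fun x hx => hx.elim⟩
      obtain ⟨u, huA, -, k, hk, hst⟩ := h0.extend hf hg fi gi hA hB (Set.empty_subset A)
        hne.ne_empty.symm le_rfl (fun k _ => hlast k) hgood
      rw [Set.sdiff_empty] at hk
      exact ⟨insert u ∅, by simpa using huA, by simp, k, by omega, hst⟩
    | succ j hj ih =>
      intro hjA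
      obtain ⟨S, hSA, hcard, k, hk, hst⟩ := ih (by omega)
      have hSne : S.Nonempty := by
        rw [← Set.ncard_pos]
        omega
      have hSneA : S ≠ A := by rintro rfl; omega
      have hn : ∀ l, k + 1 ≤ l → ∀ u, IsNext (f l) S u → u ∈ A := by
        intro l hl
        obtain ⟨l, rfl⟩ : ∃ l', l = l' + 1 := ⟨l - 1, by omega⟩
        exact hnext l S hSne hSA hSneA (hst l (by omega)).1
      obtain ⟨u, huA, huS, k', hk', hst'⟩ := hst.extend hf hg fi gi hA hB hSA hSneA
        (Nat.le_succ k) hn hgood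
      refine ⟨insert u S, Set.insert_subset huA hSA, ?_, k', ?_, hst'⟩
      · rw [Set.ncard_insert_of_notMem huS, hcard]
      · rw [Set.ncard_sdiff hSA, hcard] at hk'
        have h1 : (j + 1) * (2 * A.ncard + 1) = j * (2 * A.ncard + 1) + (2 * A.ncard + 1) := by
          ring
        have h2 : (j + 1) * (j + 1) = j * j + 2 * j + 1 := by ring
        omega
  obtain ⟨S, hSA, hcard, k, hk, hst⟩ := key A.ncard hpos le_rfl
  obtain rfl := Set.eq_of_subset_of_ncard_le hSA hcard.ge
  refine ⟨k, ?_, hst⟩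
  have h1 : S.ncard * (2 * S.ncard + 1) = S.ncard * (S.ncard + 1) + S.ncard * S.ncard := by ring
  omega

theorem Sweep.upper_or {σ : ℕ → V → ℕ} (hσ : ∀ t, Sweep G (σ t) (σ (t + 1)))
    (hi : ∀ t, (σ t).Injective) {A : Set V} (hA : G.IsClique A) (hB : G.IsClique Aᶜ) {t₀ : ℕ}
    (h : Upper (σ t₀) A) {t : ℕ} (ht : t₀ ≤ t) : Upper (σ t) A ∨ Upper (σ t) Aᶜ := by
  induction t, ht using Nat.le_induction with
  | base => exact Or.inl h
  | succ t _ ih =>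
    rcases ih with ih | ih
    · exact Or.inr ((hσ t).upper_compl (hi _) ih hA)
    · left
      have := (hσ t).upper_compl (hi _) ih hB
      rwa [compl_compl] at this

/-- After two sweeps `coNbr G (coNbr G S) ⊆ A` is a suffix. It is not inside `S`, for otherwise `S ∪
coNbr G S` would be closed under `Gᶜ`-adjacency; hence it contains the rightmost vertex outside `S`.
-/
theorem isNext_mem_of_connected {f₀ f₁ f₂ : V → ℕ} (h₁ : Sweep G f₀ f₁) (h₂ : Sweep G f₁ f₂)
    (i₁ : f₁.Injective) (i₂ : f₂.Injective) {A S : Set V} (hA : G.IsClique A)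
    (hB : G.IsClique Aᶜ) (hconn : ∀ X : Set V, X.Nonempty → coNbr G X ⊆ X → X = Set.univ)
    (hne : S.Nonempty) (hSA : S ⊆ A) (hSneA : S ≠ A) (hS : Upper f₀ S) {u : V}
    (hu : IsNext f₂ S u) : u ∈ A := by
  set T := coNbr G S with hTdef
  have hTA : T ⊆ Aᶜ := coNbr_subset_compl hA hSA
  have hT : Upper f₁ T := h₁.upper_coNbr i₁ (h₁.upper_compl i₁ hS (hA.subset hSA)) (hA.subset hSA)
  have hT2 := h₂.upper_coNbr i₂ (h₂.upper_compl i₂ hT (hB.subset hTA)) (hB.subset hTA)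
  have hTT : coNbr G T ⊆ A := by
    have := coNbr_subset_compl (A := Aᶜ) hB hTA
    rwa [compl_compl] at this
  by_cases hsub : coNbr G T ⊆ S
  · have huniv : S ∪ T = Set.univ := by
      refine hconn _ (hne.mono Set.subset_union_left) ?_
      rintro v ⟨s, hs | hs, hv⟩
      · exact Or.inr ⟨s, hs, hv⟩
      · exact Or.inl (hsub ⟨s, hs, hv⟩)
    refine absurd (hSA.antisymm fun a ha => ?_) hSneA
    have : a ∈ S ∪ T := huniv ▸ Set.mem_univ a
    exact this.resolve_right (fun h => hTA h ha)
  · obtain ⟨v, hv, hvS⟩ := Set.not_subset.1 hsub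
    by_contra huA
    have h3 := hT2 v hv u (fun h => huA (hTT h))
    have h4 := hu.2 v hvS (by rintro rfl; omega)
    omega

/-- The next ordering ends with the non-neighbours of `u`, of which there is at least one. -/
theorem Sweep.isNext_notMem {σ τ : V → ℕ} (h : Sweep G σ τ) (hτ : τ.Injective) {A : Set V}
    (hA : G.IsClique A) (hiso : ∀ v, ∃ x, Gᶜ.Adj v x) {u v : V} (hu : IsNext σ ∅ u)
    (hv : IsNext τ ∅ v) (huA : u ∈ A) : v ∉ A := by
  have hS : Upper σ {u} := by
    have := hu.upper (upper_empty σ)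
    rwa [insert_empty_eq] at this
  have hsub : {u} ⊆ A := by simpa using huA
  have hT := h.upper_coNbr hτ (h.upper_compl hτ hS (hA.subset hsub)) (hA.subset hsub)
  obtain ⟨x, hx⟩ := hiso u
  have hxT : x ∈ coNbr G {u} := ⟨u, rfl, hx⟩
  refine coNbr_subset_compl hA hsub ?_
  by_contra hvT
  have h3 := hT x hxT v hvT
  have h4 := hv.2 x (by simp) (by rintro rfl; omega)
  omega

theorem exists_upper_of_connected [Finite V] {σ : ℕ → V → ℕ}
    (hσ : ∀ t, Sweep G (σ t) (σ (t + 1))) (hi : ∀ t, (σ t).Injective) {A : Set V}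
    (hA : G.IsClique A) (hB : G.IsClique Aᶜ) (hne : A.Nonempty)
    (hconn : ∀ X : Set V, X.Nonempty → coNbr G X ⊆ X → X = Set.univ)
    (hiso : ∀ v, ∃ x, Gᶜ.Adj v x) :
    ∃ t, t + 1 ≤ A.ncard * (A.ncard + 1) ∧ Upper (σ t) A := by
  have huniv : (∅ᶜ : Set V).Nonempty := by
    obtain ⟨x, -⟩ := hne
    exact ⟨x, by simp⟩
  choose l hl using fun t => exists_isNext (hi t) huniv
  have hlu : ∀ t u, IsNext (σ t) ∅ u → u = l t := by
    intro t u hu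
    by_contra hne'
    have h1 := (hl t).2 u (by simp) hne'
    have h2 := hu.2 (l t) (by simp) (Ne.symm hne')
    omega
  have halt : ∀ t, l t ∈ A → l (t + 1) ∉ A := fun t ht =>
    (hσ t).isNext_notMem (hi _) hA hiso (hl t) (hl _) ht
  have halt' : ∀ t, l t ∉ A → l (t + 1) ∈ A := fun t ht => by
    have := (hσ t).isNext_notMem (hi _) hB hiso (hl t) (hl _) ht
    simpa using this
  -- Last vertices alternate between the sides, so one of the first two orderings ends in `A`. The
  -- offset `o` costs one sweep in the bound.
  obtain ⟨o, ho, hoA⟩ : ∃ o ≤ 1, l o ∈ A := by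
    by_cases h : l 0 ∈ A
    · exact ⟨0, by omega, h⟩
    · exact ⟨1, le_rfl, halt' 0 h⟩
  have hall : ∀ k, l (o + 2 * k) ∈ A := by
    intro k
    induction k with
    | zero => exact hoA
    | succ k ih => exact halt' _ (halt _ ih)
  obtain ⟨k, hk, hst⟩ := exists_stableFrom (f := fun k => σ (o + 2 * k))
    (g := fun k => σ (o + 2 * k + 1)) (fun k => hσ _) (fun k => hσ _) (fun k => hi _)
    (fun k => hi _) hA hB hne (fun k u hu => hlu _ u hu ▸ hall k)
    (fun k S h1 h2 h3 h4 u hu => isNext_mem_of_connected (hσ (o + 2 * k)) (hσ (o + 2 * k + 1))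
      (hi _) (hi _) hA hB hconn h1 h2 h3 h4 hu) (fun k => Or.inr hiso)
  exact ⟨o + 2 * k, by omega, (hst k le_rfl).1⟩

/-- At odd times `A` comes first, eventually in a frozen order, so its verdict on two vertices of
`Aᶜ` repeats. If `A` does not separate them, the sweep in between reverses them and the tie rule
reverses them back. -/
theorem exists_periodic_of_upper [Finite V] {σ : ℕ → V → ℕ}
    (hσ : ∀ t, Sweep G (σ t) (σ (t + 1))) (hi : ∀ t, (σ t).Injective) {A : Set V}
    (hA : G.IsClique A) (hB : G.IsClique Aᶜ) (hup : Upper (σ 0) A) :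
    ∃ t, t ≤ A.ncard * (A.ncard + 1) - 2 + 1 ∧ ∀ u v, σ t u < σ t v → σ (t + 2) u < σ (t + 2) v := by
  have hupc : ∀ t, Upper (σ t) A → Upper (σ (t + 1)) Aᶜ := fun t h =>
    (hσ t).upper_compl (hi _) h hA
  have hupc' : ∀ t, Upper (σ t) Aᶜ → Upper (σ (t + 1)) A := fun t h => by
    have := (hσ t).upper_compl (hi _) h hB
    rwa [compl_compl] at this
  have hall : ∀ k, Upper (σ (2 * k)) A := by
    intro k
    induction k with
    | zero => exact hup
    | succ k ih => exact hupc' _ (hupc _ ih)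
  obtain ⟨k, hk, hst⟩ : ∃ k, 2 * k ≤ A.ncard * (A.ncard + 1) - 2 ∧
      StableFrom (fun k => σ (2 * k)) A k := by
    rcases A.eq_empty_or_nonempty with rfl | hne
    -- For empty `A` the truncated bound is `0`.
    · exact ⟨0, by omega, fun k _ => ⟨upper_empty _, fun x hx => hx.elim⟩⟩
    have hn : ∀ k S, S ⊆ A → S ≠ A → ∀ u, IsNext (σ (2 * k)) S u → u ∈ A := by
      intro k S hSA hSneA u hu
      by_contra huA
      obtain ⟨a, ha, haS⟩ := Set.exists_of_ssubset (hSA.ssubset_of_ne hSneA)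
      have h1 := hall k a ha u huA
      have h2 := hu.2 a haS (fun e => huA (e ▸ ha))
      omega
    obtain ⟨k, hk, hst⟩ := exists_stableFrom (f := fun k => σ (2 * k))
      (g := fun k => σ (2 * k + 1)) (fun k => hσ _) (fun k => hσ _) (fun k => hi _)
      (fun k => hi _) hA hB hne (fun k => hn k ∅ (Set.empty_subset A) hne.ne_empty.symm)
      (fun k S _ h1 h2 _ => hn (k + 1) S h1 h2) (fun k => Or.inl (hall (k + 1)))
    exact ⟨k, by omega, hst⟩
  refine ⟨2 * k + 1, by omega, fun u v huv => ?_⟩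
  have e2 : Upper (σ (2 * k + 2)) A := hall (k + 1)
  have o1 : Upper (σ (2 * k + 1)) Aᶜ := hupc _ (hall k)
  have o3 : Upper (σ (2 * k + 3)) Aᶜ := hupc _ e2
  have hAA : ∀ x ∈ A, ∀ y ∈ A, σ (2 * k + 1) x < σ (2 * k + 1) y →
      σ (2 * k + 3) x < σ (2 * k + 3) y := by
    intro x hx y hy hxy
    have hyx : y ≠ x := by rintro rfl; omega
    have h0 : σ (2 * k) y < σ (2 * k) x := by
      by_contra hcon
      have := (hσ (2 * k)).reverse (hi _) (hall k) hA hy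
        (lt_of_le_of_ne (not_lt.1 hcon) (fun e => hyx (hi _ e).symm))
      omega
    exact (hσ (2 * k + 2)).reverse (hi _) e2 hA hx ((hst (k + 1) (by omega)).2 y hy x hx h0)
  by_cases hu : u ∈ A
  · by_cases hv : v ∈ A
    · exact hAA u hu v hv huv
    · exact o3 v hv u (by simpa using hu)
  · by_cases hv : v ∈ A
    · have := o1 u hu v (by simpa using hv)
      omega
    · by_contra hcon
      have hne : u ≠ v := by rintro rfl; omega
      have hlt : σ (2 * k + 2 + 1) v < σ (2 * k + 2 + 1) u :=
        lt_of_le_of_ne (not_lt.1 hcon) (fun e => hne (hi _ e).symm)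
      have hmem : ∀ w x y, G.Adj w x → ¬ G.Adj w y → y ∉ A → w ≠ y → w ∈ A :=
        fun w x y _ h hy hwy => mem_of_adj_of_clique_compl hB hy hwy h
      rcases hσ (2 * k) u v huv with ⟨w, hw, hwu, hwv, hag⟩ | ⟨hag, -⟩
      · have hwA : w ∈ A := hmem w u v hwu hwv hv (by rintro rfl; omega)
        rcases hσ (2 * k + 2) v u hlt with ⟨z, hz, hzv, hzu, hag'⟩ | ⟨hag', -⟩
        · have hzA : z ∈ A := hmem z v u hzv hzu hu (by rintro rfl; omega)
          have hwz : w ≠ z := by rintro rfl; exact hzu hwu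
          rcases lt_or_gt_of_ne (fun e => hwz (hi (2 * k + 1) e)) with h | h
          · exact hwv ((hag' w (hAA w hwA z hzA h)).2 hwu)
          · exact hzu ((hag z h).2 hzv)
        · exact hwv ((hag' w (o3 v hv w (by simpa using hwA))).2 hwu)
      · rcases hσ (2 * k + 2) v u hlt with ⟨z, hz, hzv, hzu, hag'⟩ | ⟨-, h2⟩
        · have hzA : z ∈ A := hmem z v u hzv hzu hu (by rintro rfl; omega)
          exact hzu ((hag z (o1 u hu z (by simpa using hzA))).2 hzv)
        · have : σ (2 * k + 2) v < σ (2 * k + 2) u :=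
            (hσ (2 * k + 1)).reverse (hi _) o1 hB hv huv
          omega

end Stabilisation

/-! ### From labels to the pairwise description of a sweep -/

theorem le_rightmost {V : Type*} [Fintype V] [DecidableEq V]
    (σ : VertexOrdering V) (T : Finset V) (hT : T.Nonempty) {v : V} (hv : v ∈ T) :
    σ v ≤ σ (rightmost σ T hT) := by
  unfold rightmost
  rw [Equiv.apply_symm_apply]
  exact Finset.le_max' _ _ (Finset.mem_image_of_mem _ hv)

section Positions

variable {V : Type*} [Fintype V] [DecidableEq V] (G : SimpleGraph V) [DecidableRel G.Adj]

theorem run_succ_visited (σ : VertexOrdering V) {i : ℕ} (hi : i < Fintype.card V) :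
    ∃ hT : (run G σ i).tied.Nonempty,
      (run G σ (i + 1)).visited = (run G σ i).visited ++ [rightmost σ _ hT] ∧
      ∀ w, (run G σ (i + 1)).label w =
        if w ∉ (run G σ i).visited ++ [rightmost σ _ hT] ∧ G.Adj (rightmost σ _ hT) w then
          (run G σ i).label w ++ [Fintype.card V - (i + 1)] else (run G σ i).label w := by
  have hT : (run G σ i).tied.Nonempty := by
    by_contra hT
    have h1 := (run_visited G σ (i + 1) hi).2
    have h2 := (run_visited G σ i hi.le).2
    simp only [run, step, dif_neg hT] at h1
    omega
  refine ⟨hT, ?_, fun w => ?_⟩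
  · simp only [run, step, dif_pos hT]
  · simp only [run, step, dif_pos hT]

theorem run_visited_prefix (σ : VertexOrdering V) {i j : ℕ} (hij : i ≤ j)
    (hj : j ≤ Fintype.card V) : (run G σ i).visited <+: (run G σ j).visited := by
  induction j, hij using Nat.le_induction with
  | base => exact List.prefix_rfl
  | succ j hij ih =>
    obtain ⟨hT, h, -⟩ := run_succ_visited G σ (i := j) hj
    rw [h]
    exact (ih (by omega)).trans (List.prefix_append _ _)

theorem getElem_run_lexBFSPlus (σ : VertexOrdering V) (v : V) :
    ∃ h : (lexBFSPlus G σ v : ℕ) < (run G σ (Fintype.card V)).visited.length,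
      (run G σ (Fintype.card V)).visited[(lexBFSPlus G σ v : ℕ)] = v := by
  have h : (lexBFSPlus G σ).symm (lexBFSPlus G σ v) = v := Equiv.symm_apply_apply _ _
  refine ⟨?_, ?_⟩
  · rw [(run_visited G σ _ le_rfl).2]
    exact (lexBFSPlus G σ v).2
  · exact h

theorem mem_run_visited_iff (σ : VertexOrdering V) {i : ℕ} (hi : i ≤ Fintype.card V) (v : V) :
    v ∈ (run G σ i).visited ↔ (lexBFSPlus G σ v : ℕ) < i := by
  obtain ⟨hnd, hlen⟩ := run_visited G σ _ le_rfl
  obtain ⟨-, hleni⟩ := run_visited G σ i hi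
  obtain ⟨hlt, hv⟩ := getElem_run_lexBFSPlus G σ v
  have hp := run_visited_prefix G σ hi le_rfl
  constructor
  · intro hmem
    obtain ⟨k, hk, e⟩ := List.getElem_of_mem hmem
    have e' := hp.getElem hk
    have : k = (lexBFSPlus G σ v : ℕ) := by
      refine (hnd.getElem_inj_iff (hi := by omega) (hj := hlt)).1 ?_
      rw [← e', e, hv]
    omega
  · intro hlt'
    have e' := hp.getElem (i := (lexBFSPlus G σ v : ℕ)) (by omega)
    rw [hv] at e'
    rw [← e']
    exact List.getElem_mem _

theorem rightmost_run (σ : VertexOrdering V) (u : V)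
    (hT : (run G σ (lexBFSPlus G σ u)).tied.Nonempty) : rightmost σ _ hT = u := by
  have hi := (lexBFSPlus G σ u).2
  obtain ⟨hT', h, -⟩ := run_succ_visited G σ hi
  have h1 := (mem_run_visited_iff G σ hi u).2 (Nat.lt_succ_self _)
  have h2 := mt (mem_run_visited_iff G σ hi.le u).1 (lt_irrefl _)
  rw [h, List.mem_append, List.mem_singleton] at h1
  exact (h1.resolve_left h2).symm

theorem lt_append_of_forall_lt (c l l' : List ℕ) (a : ℕ) (h : ∀ x ∈ l', x < a) :
    c ++ l' < c ++ a :: l := by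
  induction c with
  | nil =>
    cases l' with
    | nil => exact List.Lex.nil
    | cons b l' => exact List.Lex.rel (h b (by simp))
  | cons b c ih => exact List.Lex.cons ih

/-- The first vertex among those at positions below `i` that tells `u` and `v` apart is a neighbour
of `u`, and this is visible in the labels. -/
def Ahead (σ : VertexOrdering V) (i : ℕ) (u v : V) : Prop :=
  (∃ w, (lexBFSPlus G σ w : ℕ) < i ∧ G.Adj w u ∧ ¬ G.Adj w v ∧
    ∀ x, lexBFSPlus G σ x < lexBFSPlus G σ w → (G.Adj x u ↔ G.Adj x v)) ∧
  ∃ c a l l', (run G σ i).label u = c ++ a :: l ∧ (run G σ i).label v = c ++ l' ∧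
    (∀ x ∈ l', x < a) ∧ Fintype.card V - i ≤ a

theorem label_succ (σ : VertexOrdering V) (x w : V) (hw : lexBFSPlus G σ x < lexBFSPlus G σ w) :
    (run G σ (lexBFSPlus G σ x + 1)).label w =
      (run G σ (lexBFSPlus G σ x)).label w ++
        if G.Adj x w then [Fintype.card V - ((lexBFSPlus G σ x : ℕ) + 1)] else [] := by
  obtain ⟨hT, h, hl⟩ := run_succ_visited G σ (lexBFSPlus G σ x).2
  have hnot : w ∉ (run G σ (lexBFSPlus G σ x)).visited ++ [rightmost σ _ hT] := by
    rw [← h, mem_run_visited_iff G σ (lexBFSPlus G σ x).2]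
    have : (lexBFSPlus G σ x : ℕ) < lexBFSPlus G σ w := hw
    omega
  rw [hl w, rightmost_run]
  rw [rightmost_run] at hnot
  by_cases hadj : G.Adj x w <;> simp [hadj, hnot]

/-- Letters decrease with time: the bound `Fintype.card V - i ≤ a` puts every later letter below
`a`, so the comparison of labels is settled for good. -/
theorem Ahead.succ {σ : VertexOrdering V} {x u v : V}
    (h : Ahead G σ (lexBFSPlus G σ x) u v)
    (hu : lexBFSPlus G σ x < lexBFSPlus G σ u) (hv : lexBFSPlus G σ x < lexBFSPlus G σ v) :
    Ahead G σ (lexBFSPlus G σ x + 1) u v := by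
  obtain ⟨⟨w, hw, hw'⟩, c, a, l, l', h1, h2, h3, h4⟩ := h
  refine ⟨⟨w, by omega, hw'⟩, c, a,
    l ++ if G.Adj x u then [Fintype.card V - ((lexBFSPlus G σ x : ℕ) + 1)] else [],
    l' ++ if G.Adj x v then [Fintype.card V - ((lexBFSPlus G σ x : ℕ) + 1)] else [],
    ?_, ?_, ?_, by omega⟩
  · rw [label_succ G σ x u hu, h1, List.append_assoc, List.cons_append]
  · rw [label_succ G σ x v hv, h2, List.append_assoc]
  · intro y hy
    rw [List.mem_append] at hy
    rcases hy with hy | hy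
    · exact h3 y hy
    · have := (lexBFSPlus G σ x).2
      split_ifs at hy
      · rw [List.mem_singleton] at hy
        omega
      · simp at hy

theorem label_trichotomy (σ : VertexOrdering V) {i : ℕ} {u v : V}
    (hu : i ≤ lexBFSPlus G σ u) (hv : i ≤ lexBFSPlus G σ v) :
    ((∀ x, (lexBFSPlus G σ x : ℕ) < i → (G.Adj x u ↔ G.Adj x v)) ∧
      (run G σ i).label u = (run G σ i).label v) ∨ Ahead G σ i u v ∨ Ahead G σ i v u := by
  induction i with
  | zero => exact Or.inl ⟨fun x hx => absurd hx (Nat.not_lt_zero _), rfl⟩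
  | succ i ih =>
    have hi : i < Fintype.card V := by
      have := (lexBFSPlus G σ u).2
      omega
    obtain ⟨x, hx⟩ : ∃ x, (lexBFSPlus G σ x : ℕ) = i :=
      ⟨(lexBFSPlus G σ).symm ⟨i, hi⟩, by simp⟩
    subst hx
    have hu' : lexBFSPlus G σ x < lexBFSPlus G σ u := hu
    have hv' : lexBFSPlus G σ x < lexBFSPlus G σ v := hv
    rcases ih (by omega) (by omega) with ⟨hag, hl⟩ | h | h
    · have key : ∀ u v : V, lexBFSPlus G σ x < lexBFSPlus G σ u →
          lexBFSPlus G σ x < lexBFSPlus G σ v →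
          (∀ y, (lexBFSPlus G σ y : ℕ) < lexBFSPlus G σ x → (G.Adj y u ↔ G.Adj y v)) →
          (run G σ (lexBFSPlus G σ x)).label u = (run G σ (lexBFSPlus G σ x)).label v →
          G.Adj x u → ¬ G.Adj x v → Ahead G σ (lexBFSPlus G σ x + 1) u v := by
        intro u v hu hv hag hl hxu hxv
        refine ⟨⟨x, by omega, hxu, hxv, fun y hy => hag y hy⟩,
          (run G σ (lexBFSPlus G σ x)).label v,
          Fintype.card V - ((lexBFSPlus G σ x : ℕ) + 1), [], [], ?_, ?_, by simp, le_rfl⟩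
        · rw [label_succ G σ x u hu, if_pos hxu, hl]
        · rw [label_succ G σ x v hv, if_neg hxv]
      by_cases hxu : G.Adj x u <;> by_cases hxv : G.Adj x v
      · left
        refine ⟨fun y hy => ?_, ?_⟩
        · rcases Nat.lt_succ_iff_lt_or_eq.1 hy with hy | hy
          · exact hag y hy
          · rw [(lexBFSPlus G σ).injective (Fin.ext hy)]
            simp [hxu, hxv]
        · rw [label_succ G σ x u hu', label_succ G σ x v hv', hl]
          simp [hxu, hxv]
      · exact Or.inr (Or.inl (key u v hu' hv' hag hl hxu hxv))
      · exact Or.inr (Or.inr (key v u hv' hu' (fun y hy => (hag y hy).symm) hl.symm hxv hxu))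
      · left
        refine ⟨fun y hy => ?_, ?_⟩
        · rcases Nat.lt_succ_iff_lt_or_eq.1 hy with hy | hy
          · exact hag y hy
          · rw [(lexBFSPlus G σ).injective (Fin.ext hy)]
            simp [hxu, hxv]
        · rw [label_succ G σ x u hu', label_succ G σ x v hv', hl]
          simp [hxu, hxv]
    · exact Or.inr (Or.inl (h.succ G hu' hv'))
    · exact Or.inr (Or.inr (h.succ G hv' hu'))

/-- When `u` is visited its label is maximal, so `v` is not ahead of it; equal labels make `v` a
tied vertex, hence left of `u` in `σ`. -/
theorem sweep_lexBFSPlus (σ : VertexOrdering V) :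
    Sweep G (fun v => (σ v : ℕ)) (fun v => (lexBFSPlus G σ v : ℕ)) := by
  intro u v huv
  change (lexBFSPlus G σ u : ℕ) < lexBFSPlus G σ v at huv
  obtain ⟨hT, -, -⟩ := run_succ_visited G σ (lexBFSPlus G σ u).2
  have hmem := rightmost_mem σ _ hT
  have hle := fun v => @le_rightmost V _ _ σ _ hT v
  rw [rightmost_run] at hmem hle
  have hvun : v ∈ (run G σ (lexBFSPlus G σ u)).unvisited := by
    refine Finset.mem_filter.2 ⟨Finset.mem_univ _, ?_⟩
    rw [mem_run_visited_iff G σ (lexBFSPlus G σ u).2.le]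
    omega
  have hlab := (Finset.mem_filter.1 hmem).2 v hvun
  rcases label_trichotomy G σ (u := u) (v := v) le_rfl huv.le with ⟨hag, hl⟩ | h | h
  · refine Or.inr ⟨hag, ?_⟩
    have hv : v ∈ (run G σ (lexBFSPlus G σ u)).tied :=
      Finset.mem_filter.2 ⟨hvun, fun w hw => hl ▸ (Finset.mem_filter.1 hmem).2 w hw⟩
    refine lt_of_le_of_ne (hle v hv) (fun e => ?_)
    rw [σ.injective (Fin.ext e)] at huv
    exact lt_irrefl _ huv
  · exact Or.inl h.1
  · obtain ⟨-, c, a, l, l', h1, h2, h3, -⟩ := h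
    rw [h1, h2] at hlab
    exact absurd hlab (not_le.2 (lt_append_of_forall_lt c l l' a h3))

end Positions

/-! ### Components of the complement -/

section Components

variable {V : Type*} {G : SimpleGraph V}

/-- A vertex that tells two members of `C` apart misses one of them and so belongs to `C`. -/
theorem Sweep.induce {σ τ : V → ℕ} (h : Sweep G σ τ) {C : Set V}
    (hC : ∀ x ∈ C, ∀ y, Gᶜ.Adj x y → y ∈ C) :
    Sweep (G.induce C) (fun v => σ v) (fun v => τ v) := by
  intro u v huv
  rcases h u v huv with ⟨w, hw, hwu, hwv, hag⟩ | ⟨hag, hlt⟩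
  · have hne : (v : V) ≠ w := by
      intro e
      have huv' : τ u < τ v := huv
      rw [e] at huv'
      omega
    have hwC : w ∈ C := hC v v.2 w ((SimpleGraph.compl_adj _ _ _).2 ⟨hne, fun e => hwv e.symm⟩)
    exact Or.inl ⟨⟨w, hwC⟩, hw, hwu, hwv, fun x hx => hag x hx⟩
  · exact Or.inr ⟨fun x hx => hag x hx, hlt⟩

theorem isClique_induce {A : Set V} (hA : G.IsClique A) (C : Set V) :
    (G.induce C).IsClique {v : C | (v : V) ∈ A} :=
  fun _ hu _ hv hne => hA hu hv (fun e => hne (Subtype.ext e))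

theorem exists_small_side [Finite V] {A : Set V} (hA : G.IsClique A) (hB : G.IsClique Aᶜ) :
    ∃ D : Set V, G.IsClique D ∧ G.IsClique Dᶜ ∧ 2 * D.ncard ≤ Nat.card V := by
  have h := Set.ncard_add_ncard_compl A
  by_cases hle : A.ncard ≤ Aᶜ.ncard
  · exact ⟨A, hA, hB, by omega⟩
  · exact ⟨Aᶜ, hB, by rwa [compl_compl], by omega⟩

/-- After quadratically many sweeps, no vertex lies between two of its non-neighbours. -/
theorem not_between [Finite V] {σ : ℕ → V → ℕ} (hσ : ∀ t, Sweep G (σ t) (σ (t + 1)))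
    (hi : ∀ t, (σ t).Injective) {A : Set V} (hA : G.IsClique A) (hB : G.IsClique Aᶜ) {N t : ℕ}
    (hN : Nat.card V ≤ 2 * N + 1) (ht : N * (N + 1) ≤ t + 1) {x u y : V} (hxu : Gᶜ.Adj x u)
    (huy : Gᶜ.Adj u y) (h1 : σ t x < σ t u) : ¬ σ t u < σ t y := by
  intro h2
  set C : Set V := {v | Gᶜ.Reachable u v} with hCdef
  have hC : ∀ x ∈ C, ∀ y, Gᶜ.Adj x y → y ∈ C := fun a ha b hab =>
    SimpleGraph.Reachable.trans ha hab.reachable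
  have huC : u ∈ C := SimpleGraph.Reachable.refl u
  have hxC : x ∈ C := hC u huC x hxu.symm
  have hyC : y ∈ C := hC u huC y huy
  have hadj : ∀ a b : C, (G.induce C)ᶜ.Adj a b ↔ Gᶜ.Adj (a : V) b := by
    intro a b
    simp [SimpleGraph.compl_adj, Subtype.ext_iff]
  have hconn : ∀ X : Set C, X.Nonempty → coNbr (G.induce C) X ⊆ X → X = Set.univ := by
    rintro X ⟨x₀, hx₀⟩ hX
    refine Set.eq_univ_of_forall ?_
    have hreach : ∀ b, Relation.ReflTransGen Gᶜ.Adj (x₀ : V) b → ∃ hb : b ∈ C, ⟨b, hb⟩ ∈ X := by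
      intro b hb
      induction hb with
      | refl => exact ⟨x₀.2, hx₀⟩
      | tail _ hab ih =>
        obtain ⟨ha, haX⟩ := ih
        exact ⟨hC _ ha _ hab, hX ⟨_, haX, (hadj _ _).2 hab⟩⟩
    intro v
    have hr : Gᶜ.Reachable (x₀ : V) v :=
      SimpleGraph.Reachable.trans (SimpleGraph.Reachable.symm x₀.2) v.2
    exact (hreach v ((SimpleGraph.reachable_iff_reflTransGen _ _).1 hr)).2
  have hiso : ∀ v : C, ∃ x, (G.induce C)ᶜ.Adj v x := by
    intro v
    by_contra! hv
    have huniv := hconn {v} (Set.singleton_nonempty v)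
      (by rintro w ⟨s, rfl, hsw⟩; exact absurd hsw (hv w))
    have hx : (⟨x, hxC⟩ : C) ∈ ({v} : Set C) := huniv ▸ Set.mem_univ _
    have hu : (⟨u, huC⟩ : C) ∈ ({v} : Set C) := huniv ▸ Set.mem_univ _
    rw [Set.mem_singleton_iff] at hx hu
    exact hxu.ne (Subtype.ext_iff.1 (hx.trans hu.symm))
  obtain ⟨D, hD, hD', hcard⟩ := exists_small_side (isClique_induce hA C) (isClique_induce hB C)
  have hne : D.Nonempty := by
    rw [Set.nonempty_iff_ne_empty]
    rintro rfl
    rw [Set.compl_empty] at hD'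
    have hxu' := (hadj ⟨x, hxC⟩ ⟨u, huC⟩).2 hxu
    rw [SimpleGraph.compl_adj] at hxu'
    exact hxu'.2 (hD' (Set.mem_univ _) (Set.mem_univ _) hxu'.1)
  have hi' : ∀ t, Function.Injective (fun v : C => σ t v) := fun t =>
    (hi t).comp Subtype.val_injective
  obtain ⟨t₀, ht₀, hup⟩ := exists_upper_of_connected (σ := fun t (v : C) => σ t v)
    (fun t => (hσ t).induce hC) hi' hD hD' hne hconn hiso
  have hcardC : Nat.card C ≤ Nat.card V := Nat.card_le_card_of_injective _ Subtype.val_injective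
  have hDN : D.ncard ≤ N := by omega
  have hle : D.ncard * (D.ncard + 1) ≤ N * (N + 1) := by gcongr
  have hor := Sweep.upper_or (fun t => (hσ t).induce hC) hi' hD hD' hup (t := t) (by omega)
  have hxu' := (hadj ⟨x, hxC⟩ ⟨u, huC⟩).2 hxu
  have huy' := (hadj ⟨u, huC⟩ ⟨y, hyC⟩).2 huy
  -- Non-neighbours of `u` lie on the side opposite to `u`; were one side a suffix, they would all
  -- be before `u` or all after it.
  have key : ∀ E : Set C, (G.induce C).IsClique E → (G.induce C).IsClique Eᶜ →
      ¬ Upper (fun v : C => σ t v) E := by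
    intro E hE hE' hupE
    rw [SimpleGraph.compl_adj] at hxu' huy'
    by_cases huE : (⟨u, huC⟩ : C) ∈ E
    · have hyE : (⟨y, hyC⟩ : C) ∉ E := fun hyE => huy'.2 (hE huE hyE huy'.1)
      have h3 : σ t y < σ t u := hupE _ huE _ hyE
      omega
    · have hxE : (⟨x, hxC⟩ : C) ∈ E := mem_of_adj_of_clique_compl hE' huE hxu'.1 hxu'.2
      have h3 : σ t u < σ t x := hupE _ hxE _ huE
      omega
  rcases hor with hor | hor
  · exact key D hD hD' hor
  · exact key Dᶜ hD' (by rwa [compl_compl]) hor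

/-- `R` collects the vertices with an earlier non-neighbour. Of two non-adjacent vertices the later
is in `R`, and by `hmid` the earlier is not. A vertex outside `R` sees all that precedes it, so it
would have been chosen ahead of any member of `R`. -/
theorem exists_upper_clique {σ τ : V → ℕ} (h : Sweep G σ τ) (hτ : τ.Injective)
    (hmid : ∀ x u y, Gᶜ.Adj x u → Gᶜ.Adj u y → τ x < τ u → ¬ τ u < τ y) :
    ∃ R : Set V, G.IsClique R ∧ G.IsClique Rᶜ ∧ Upper τ R := by
  refine ⟨{v | ∃ x, Gᶜ.Adj x v ∧ τ x < τ v}, ?_, ?_, ?_⟩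
  · rintro u ⟨x, hxu, hx⟩ v ⟨y, hyv, hy⟩ hne
    by_contra hadj
    have huv : Gᶜ.Adj u v := (SimpleGraph.compl_adj _ _ _).2 ⟨hne, hadj⟩
    rcases lt_or_gt_of_ne (fun e => hne (hτ e)) with hlt | hlt
    · exact hmid x u v hxu huv hx hlt
    · exact hmid y v u hyv huv.symm hy hlt
  · intro u hu v hv hne
    by_contra hadj
    have huv : Gᶜ.Adj u v := (SimpleGraph.compl_adj _ _ _).2 ⟨hne, hadj⟩
    rcases lt_or_gt_of_ne (fun e => hne (hτ e)) with hlt | hlt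
    · exact hv ⟨u, huv, hlt⟩
    · exact hu ⟨v, huv.symm, hlt⟩
  · rintro v ⟨x, hxv, hx⟩ u hu
    have hadj : ∀ w, τ w < τ u → G.Adj w u := by
      intro w hw
      by_contra hwu
      exact hu ⟨w, (SimpleGraph.compl_adj _ _ _).2 ⟨by rintro rfl; omega, hwu⟩, hw⟩
    by_contra hcon
    have hne : v ≠ u := by rintro rfl; exact hu ⟨x, hxv, hx⟩
    have hlt : τ v < τ u := lt_of_le_of_ne (not_lt.1 hcon) (fun e => hne (hτ e))
    rcases h v u hlt with ⟨w, hw, -, hwu, -⟩ | ⟨hag, -⟩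
    · exact hwu (hadj w (by omega))
    · rw [SimpleGraph.compl_adj] at hxv
      exact hxv.2 ((hag x hx).2 (hadj x (by omega)))

theorem exists_periodic [Finite V] {σ : ℕ → V → ℕ} (hσ : ∀ t, Sweep G (σ t) (σ (t + 1)))
    (hi : ∀ t, (σ t).Injective) {A : Set V} (hA : G.IsClique A) (hB : G.IsClique Aᶜ)
    (hn : 2 ≤ Nat.card V) :
    ∃ t, t < Nat.card V ^ 2 ∧ ∀ u v, σ t u < σ t v → σ (t + 2) u < σ (t + 2) v := by
  -- Separating the sides takes `T + 1 = N * (N + 1) - 1` sweeps, passing to the smaller side at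
  -- most one, freezing it at most `N * (N + 1) - 1`: in all at most `2N² + 2N - 1 < 4N² ≤ n²`.
  obtain ⟨N, hN1, hN2⟩ : ∃ N, 2 * N ≤ Nat.card V ∧ Nat.card V ≤ 2 * N + 1 :=
    ⟨Nat.card V / 2, by omega, by omega⟩
  have hN : 1 ≤ N := by omega
  have hNN : 2 ≤ N * (N + 1) := by nlinarith
  obtain ⟨T, hT⟩ : ∃ T, T + 2 = N * (N + 1) := ⟨N * (N + 1) - 2, by omega⟩
  obtain ⟨R, hR, hR', hup⟩ := exists_upper_clique (hσ T) (hi (T + 1)) (fun x u y hxu huy h =>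
    not_between hσ hi hA hB hN2 (by omega) hxu huy h)
  have hsmall : ∃ D : Set V, G.IsClique D ∧ G.IsClique Dᶜ ∧ 2 * D.ncard ≤ Nat.card V ∧
      ∃ o ≤ 1, Upper (σ (T + 1 + o)) D := by
    have h := Set.ncard_add_ncard_compl R
    by_cases hle : R.ncard ≤ Rᶜ.ncard
    · exact ⟨R, hR, hR', by omega, 0, by omega, hup⟩
    · exact ⟨Rᶜ, hR', by rwa [compl_compl], by omega, 1, le_rfl,
        (hσ (T + 1)).upper_compl (hi _) hup hR⟩
  obtain ⟨D, hD, hD', hcard, o, ho, hupD⟩ := hsmall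
  obtain ⟨t, ht, hper⟩ := exists_periodic_of_upper (σ := fun t => σ (T + 1 + o + t))
    (fun t => hσ _) (fun t => hi _) hD hD' hupD
  refine ⟨T + 1 + o + t, ?_, hper⟩
  have hDN : D.ncard ≤ N := by omega
  have hle : D.ncard * (D.ncard + 1) ≤ N * (N + 1) := by gcongr
  have hsq : (2 * N) ^ 2 ≤ Nat.card V ^ 2 := by gcongr
  have hNsq : N ≤ N * N := Nat.le_mul_self N
  have e1 : (2 * N) ^ 2 = 4 * (N * N) := by ring
  have e2 : N * (N + 1) = N * N + N := by ring
  omega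

end Components

/-! ### Back to orderings as bijections -/

section Orderings

variable {V : Type*} [Fintype V]

theorem VertexOrdering.eq_of_lt_imp_lt {σ τ : VertexOrdering V}
    (h : ∀ u v, (σ u : ℕ) < σ v → (τ u : ℕ) < τ v) : σ = τ := by
  have hmono : StrictMono (σ.symm.trans τ) := by
    intro i j hij
    exact h _ _ (by simpa using hij)
  have hid : (StrictMono.orderIsoOfSurjective _ hmono (σ.symm.trans τ).surjective) =
      OrderIso.refl (Fin (Fintype.card V)) := Subsingleton.elim _ _
  ext v
  have := congrArg (fun e : Fin (Fintype.card V) ≃o Fin (Fintype.card V) => e (σ v)) hid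
  simp only [StrictMono.coe_orderIsoOfSurjective, Equiv.trans_apply, Equiv.symm_apply_apply,
    OrderIso.refl_apply] at this
  rw [this]

variable [DecidableEq V] (G : SimpleGraph V) [DecidableRel G.Adj]

/-- Nothing precedes the first vertex of a sweep, so the tie rule places it right of the second in
`σ`. -/
theorem lexBFSPlus_ne (hn : 2 ≤ Fintype.card V) (σ : VertexOrdering V) : lexBFSPlus G σ ≠ σ := by
  intro e
  obtain ⟨u, hu⟩ : ∃ u, (σ u : ℕ) = 0 := ⟨σ.symm ⟨0, by omega⟩, by simp⟩
  obtain ⟨v, hv⟩ : ∃ v, (σ v : ℕ) = 1 := ⟨σ.symm ⟨1, by omega⟩, by simp⟩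
  have h := sweep_lexBFSPlus G σ u v
  simp only [e, hu, hv] at h
  rcases h Nat.zero_lt_one with ⟨w, hw, -⟩ | ⟨-, h⟩ <;> omega

theorem IsCobipartite.exists_cliques {V : Type*} {G : SimpleGraph V} (hG : IsCobipartite G) :
    ∃ A : Set V, G.IsClique A ∧ G.IsClique Aᶜ := by
  obtain ⟨c⟩ := hG
  have hc : ∀ u v, u ≠ v → c u = c v → G.Adj u v := by
    intro u v hne e
    by_contra h
    exact c.valid ((SimpleGraph.compl_adj _ _ _).2 ⟨hne, h⟩) e
  refine ⟨{v | c v = 0}, fun u hu v hv hne => hc u v hne (hu.trans hv.symm), ?_⟩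
  intro u hu v hv hne
  refine hc u v hne ?_
  have h1 : c u ≠ 0 := hu
  have h2 : c v ≠ 0 := hv
  omega

theorem exists_iterate_lexBFSPlus (hn : 2 ≤ Fintype.card V) (hG : IsCobipartite G)
    (σ₀ : VertexOrdering V) : ∃ t : ℕ, t < Fintype.card V ^ 2 ∧
      (lexBFSPlus G)^[t + 2] σ₀ = (lexBFSPlus G)^[t] σ₀ ∧
      (lexBFSPlus G)^[t + 1] σ₀ ≠ (lexBFSPlus G)^[t] σ₀ := by
  obtain ⟨A, hA, hB⟩ := hG.exists_cliques
  obtain ⟨t, ht, hper⟩ := exists_periodic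
    (σ := fun t v => ((lexBFSPlus G)^[t] σ₀ v : ℕ))
    (fun t => by
      simp only [Function.iterate_succ_apply']
      exact sweep_lexBFSPlus G _)
    (fun t => Fin.val_injective.comp ((lexBFSPlus G)^[t] σ₀).injective) hA hB
    (by rwa [Nat.card_eq_fintype_card])
  rw [Nat.card_eq_fintype_card] at ht
  refine ⟨t, ht, (VertexOrdering.eq_of_lt_imp_lt hper).symm, ?_⟩
  rw [Function.iterate_succ_apply']
  exact lexBFSPlus_ne G hn _

end Orderings

end LexSearch

theorem mainTheorem4 {V : Type*} [Fintype V] [DecidableEq V] (G : SimpleGraph V)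
    [DecidableRel G.Adj] (hn : 2 ≤ Fintype.card V) (hG : LexSearch.IsCobipartite G) :
    LexSearch.lexCycle G = 2 ∧
    ∀ σ₀ : LexSearch.VertexOrdering V, ∃ t : ℕ, t < Fintype.card V ^ 2 ∧
      (LexSearch.lexBFSPlus G)^[t + 2] σ₀ = (LexSearch.lexBFSPlus G)^[t] σ₀ ∧
      (LexSearch.lexBFSPlus G)^[t + 1] σ₀ ≠ (LexSearch.lexBFSPlus G)^[t] σ₀ := by
  have hmain := LexSearch.exists_iterate_lexBFSPlus G hn hG
  refine ⟨le_antisymm (Finset.sup_le fun σ _ => ?_) ?_, hmain⟩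
  · by_cases hσ : σ ∈ Function.periodicPts (LexSearch.lexBFSPlus G)
    · obtain ⟨t, -, h2, -⟩ := hmain σ
      -- The minimal period is constant along a cycle, so it can be read off after `t` sweeps.
      rw [← Function.minimalPeriod_apply_iterate hσ t]
      refine Function.IsPeriodicPt.minimalPeriod_le two_pos ?_
      rw [Function.IsPeriodicPt, Function.IsFixedPt, ← Function.iterate_add_apply, add_comm]
      exact h2
    · rw [Function.minimalPeriod_eq_zero_of_notMem_periodicPts hσ]
      exact Nat.zero_le _
  · obtain ⟨t, -, h2, h1⟩ := hmain (Fintype.equivFin V)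
    rw [add_comm, Function.iterate_add_apply] at h2
    rw [Function.iterate_succ_apply'] at h1
    refine le_trans (le_of_eq ?_) (Finset.le_sup
      (f := fun σ => Function.minimalPeriod (LexSearch.lexBFSPlus G) σ)
      (Finset.mem_univ ((LexSearch.lexBFSPlus G)^[t] (Fintype.equivFin V))))
    exact (Function.minimalPeriod_eq_prime (p := 2) h2 h1).symm
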